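/- Let $(E,d)$ be a complete metric space which is geodesic: for all $\rho,\pi\in E$ there is a geodesic from $\rho$ to $\pi$, i.e. $c:[0,1]\to E$ with $c(0)=\rho$, $c(1)=\pi$ and $d(c(s),c(t))=|t-s|\,d(\rho,\pi)$ for all $s,t\in[0,1]$. Let $\mathcal E:E\to(-\infty,+\infty]$ be lower semicontinuous with $\mathcal D(\mathcal E)=\{\mathcal E<+\infty\}\neq\emptyset$. Its local slope is $|\partial\mathcal E|(\rho)=\limsup_{\pi\to\rho,\,\pi\ne\rho}\frac{(\mathcal E(\rho)-\mathcal E(\pi))^+}{d(\rho,\pi)}$ if $\mathcal E(\rho)<+\infty$ (read as $0$ if $\rho$ is isolated), and $+\infty$ otherwise; $I=|\partial\mathcal E|^2$. Assume the following. 1. (EVI flow.) For some $\kappa\in\mathbb R$, $\mathcal E$ admits an $EVI_\kappa$ gradient flow on all of $E$: a family of continuous maps $S(t):E\to E$, $t\ge0$, such that, writing $\pi(t)=S(t)\pi$, for every $\pi \in E$ one has $S(0)\pi=\pi$ and $S(t+s)\pi=S(s)S(t)\pi$ for $s,t\ge0$, the curve $t\mapsto\pi(t)$ is continuous on $[0,\infty)$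 with $\pi(t)\in\mathcal D(\mathcal E)$ for $t>0$, and $$\tfrac12\tfrac{\mathrm d^+}{\mathrm dt}d^2(\pi(t),\rho)\le\mathcal E(\rho)-\mathcal E(\pi(t))-\tfrac\kappa2d^2(\pi(t),\rho)\qquad\forall\rho\in\mathcal D(\mathcal E),\ t\ge0,$$ where $\frac{\mathrm d^+}{\mathrm dt}$ is the upper right derivative, with values in $[-\infty,+\infty]$. 2. (Regularized geodesics.) For all $\rho,\pi\in E$ with $I(\rho)+\mathcal E(\pi)<+\infty$ there is a geodesic $c$ from $\rho$ to $\pi$ such that for every $\theta>0$ there are $\tau>0$ and a curve $c_\theta:[0,\tau]\to E$ (not necessarily a geodesic, nor continuous) with $c_\theta(0)=\rho$, $$\limsup_{t\downarrow0}\frac{d(c_\theta(t),c(t))}{t}\le\theta,\qquad \liminf_{t\downarrow0}\frac{\mathcal E(c_\theta(t))-\mathcal E(\rho)}{t}\le|\partial\mathcal E|(\rho)\,(d(\rho,\pi)+\theta).$$ Define the Tataru distance $d_T(\pi,\rho)=\inf_{t\ge0}\{t+e^{\hat\kappa t}d(\pi,\rho(t))\}$ with $\hat\kappa=\min(0,\kappa)$.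 Let $H_\dagger$ be the set of all pairs $(f^\dagger,g^\dagger)$ of functions on $E$ of the form $$f^\dagger(\pi)=\tfrac a2d^2(\pi,\rho)+b\,d_T(\pi,\mu)+c,$$ $$g^\dagger(\pi)=a[\mathcal E(\rho)-\mathcal E(\pi)]-\tfrac{a\kappa}2d^2(\pi,\rho)+b+\tfrac{a^2}2d^2(\pi,\rho)+ab\,d(\pi,\rho)+\tfrac{b^2}2,$$ with $a,b>0$, $c\in\mathbb R$, $\mu,\rho\in E$, $\mathcal E(\rho)<\infty$, and let $H_\ddagger$ be the set of all pairs $(f^\ddagger,g^\ddagger)$ of the form $$f^\ddagger(\mu)=-\tfrac a2d^2(\gamma,\mu)-b\,d_T(\mu,\pi)+c,$$ $$g^\ddagger(\mu)=a[\mathcal E(\mu)-\mathcal E(\gamma)]+\tfrac{a\kappa}2d^2(\gamma,\mu)-b+\tfrac{a^2}2d^2(\gamma,\mu)-ab\,d(\gamma,\mu)-\tfrac{b^2}2,$$ with $a,b>0$, $c\in\mathbb R$, $\pi,\gamma\in E$, $\mathcal E(\gamma)<\infty$. Let $\lambda>0$ and $h:E\to\mathbb R$. A function $u:E\to\mathbb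 R$ is a viscosity subsolution of $f-\lambda H_\dagger f=h$ if it is bounded and upper semicontinuous and for every $(f,g)\in H_\dagger$ there is a sequence $(\pi_n)$ in $E$ with $$\lim_n\,(u-f)(\pi_n)=\sup_E(u-f),\qquad\limsup_n\,\big(u(\pi_n)-\lambda g(\pi_n)-h(\pi_n)\big)\le0.$$ A function $v:E\to\mathbb R$ is a viscosity supersolution of $f-\lambda H_\ddagger f=h$ if it is bounded and lower semicontinuous and for every $(f,g)\in H_\ddagger$ there is a sequence $(\pi_n)$ in $E$ with $$\lim_n\,(v-f)(\pi_n)=\inf_E(v-f),\qquad\liminf_n\,\big(v(\pi_n)-\lambda g(\pi_n)-h(\pi_n)\big)\ge0.$$ **Theorem (comparison principle).** Let $\lambda>0$ and let $h^\dagger,h^\ddagger:E\to\mathbb R$ be bounded and uniformly continuous. If $u$ is a viscosity subsolution of $f-\lambda H_\dagger f=h^\dagger$ and $v$ is a viscosity supersolution of $f-\lambda H_\ddagger f=h^\ddagger$, then $$\sup_{\pi\in E}\big(u(\pi)-v(\pi)\big)\le\sup_{\pi\in E}\big(h^\dagger(\pi)-h^\ddagger(\pi)\big).$$ -/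

import Mathlib

open Set Filter Topology
open scoped ENNReal NNReal

noncomputable section

namespace EVIComparison

variable {X : Type*} [MetricSpace X]

/-- The effective domain of an extended functional with values in `(-∞, +∞]`. -/
def effDomain (φ : X → EReal) : Set X := {x | φ x < ⊤}

/-- The local slope: the limit superior, as `y → x` with `y ≠ x`, of `(φ x - φ y)⁺ / d(x, y)` if
`φ x < +∞`, and `+∞` otherwise. Its value at an isolated point of the domain is `0`. -/
def localSlope (φ : X → EReal) (x : X) : ℝ≥0∞ :=
  open Classical in
  if φ x < ⊤ then
    limsup (fun y => (φ x - φ y).toENNReal / edist x y) (𝓝[≠] x)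
  else ⊤

/-- The information functional, the squared slope of the energy. -/
def information (𝓔 : X → EReal) (x : X) : ℝ≥0∞ := localSlope 𝓔 x ^ 2

/-- `c` restricted to `[0, 1]` is a (constant speed) geodesic from `x` to `y`. -/
def IsGeodesic (c : ℝ → X) (x y : X) : Prop :=
  c 0 = x ∧ c 1 = y ∧
    ∀ s ∈ Icc (0 : ℝ) 1, ∀ t ∈ Icc (0 : ℝ) 1, dist (c s) (c t) = |t - s| * dist x y

/-- Any two points are joined by a geodesic. -/
def IsGeodesicSpace (X : Type*) [MetricSpace X] : Prop :=
  ∀ x y : X, ∃ c : ℝ → X, IsGeodesic c x y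

/-- The standing hypotheses on the energy: values in `(-∞, +∞]`, non-empty effective domain, lower
semicontinuity. -/
structure IsEnergy (𝓔 : X → EReal) : Prop where
  ne_bot : ∀ x, 𝓔 x ≠ ⊥
  proper : (effDomain 𝓔).Nonempty
  lsc : LowerSemicontinuous 𝓔

/-- The upper right (Dini) derivative at `t` of a real function, as an extended real. -/
def upperRightDeriv (f : ℝ → ℝ) (t : ℝ) : EReal :=
  limsup (fun s : ℝ => (((f (t + s) - f t) / s : ℝ) : EReal)) (𝓝[>] 0)

/-- `c`, restricted to `[0, ∞)`, is a solution of the evolution variational inequality `EVI_κ`. If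
`c 0` is outside the domain, the right-hand side at `t = 0` is `-∞`. -/
structure IsEVISolution (κ : ℝ) (𝓔 : X → EReal) (c : ℝ → X) : Prop where
  continuousOn : ContinuousOn c (Ici 0)
  mem_domain : ∀ t, 0 < t → c t ∈ effDomain 𝓔
  evi : ∀ ρ ∈ effDomain 𝓔, ∀ t, 0 ≤ t →
    ((1 / 2 : ℝ) : EReal) * upperRightDeriv (fun r => dist (c r) ρ ^ 2) t ≤
      𝓔 ρ - 𝓔 (c t) - ((κ / 2 * dist (c t) ρ ^ 2 : ℝ) : EReal)

/-- `S t x`, `t ≥ 0`, is an `EVI_κ` gradient flow of `𝓔` defined on the whole space; the values at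
negative times are irrelevant. -/
structure IsEVIFlow (κ : ℝ) (𝓔 : X → EReal) (S : ℝ → X → X) : Prop where
  continuous : ∀ t, 0 ≤ t → Continuous (S t)
  map_zero : ∀ x, S 0 x = x
  map_add : ∀ t s, 0 ≤ t → 0 ≤ s → ∀ x, S (t + s) x = S s (S t x)
  isSolution : ∀ x, IsEVISolution κ 𝓔 (fun t => S t x)

/-- Regularized geodesics. For `I(ρ) + 𝓔(π) < ∞` there is a geodesic `c` from `ρ` to `π` which,
for every `θ > 0`, is approximated by a curve `cθ` on some interval `[0, τ]`, issuing from `ρ`,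
whose angle with `c` is at most `θ` and along which the directional derivative of the energy is
controlled by the slope. Only the values of `cθ` near `0` on the right matter, so it is
represented by a total function and no regularity of it is required. -/
def HasRegularizedGeodesics (𝓔 : X → EReal) : Prop :=
  ∀ ρ π : X, information 𝓔 ρ < ⊤ → 𝓔 π < ⊤ →
    ∃ c : ℝ → X, IsGeodesic c ρ π ∧
      ∀ θ : ℝ, 0 < θ → ∃ cθ : ℝ → X, cθ 0 = ρ ∧
        limsup (fun t : ℝ => ((dist (cθ t) (c t) / t : ℝ) : EReal)) (𝓝[>] 0) ≤ (θ : EReal) ∧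
        liminf (fun t : ℝ => (𝓔 (cθ t) - 𝓔 ρ) / (t : EReal)) (𝓝[>] 0) ≤
          (localSlope 𝓔 ρ : EReal) * ((dist ρ π + θ : ℝ) : EReal)

/-- The Tataru distance `d_T(π, ρ) = inf_{t ≥ 0} (t + e^{κ̂ t} d(π, ρ(t)))`, `κ̂ = min 0 κ`, where
`ρ(t) = S t ρ`. -/
def tataruDist (κ : ℝ) (S : ℝ → X → X) (π ρ : X) : ℝ :=
  ⨅ t : ℝ≥0, ((t : ℝ) + Real.exp (min 0 κ * t) * dist π (S t ρ))

/-- The test functions of the upper Hamiltonian. -/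
def fUpper (κ : ℝ) (S : ℝ → X → X) (a b c : ℝ) (μ ρ : X) (π : X) : ℝ :=
  1 / 2 * a * dist π ρ ^ 2 + b * tataruDist κ S π μ + c

/-- The image of `fUpper` under the upper Hamiltonian, with values in `[-∞, +∞)`. -/
def gUpper (κ : ℝ) (𝓔 : X → EReal) (a b : ℝ) (ρ : X) (π : X) : EReal :=
  (a : EReal) * (𝓔 ρ - 𝓔 π) +
    ((-(a * (κ / 2) * dist π ρ ^ 2) + b + 1 / 2 * a ^ 2 * dist π ρ ^ 2 + a * b * dist π ρ
      + 1 / 2 * b ^ 2 : ℝ) : EReal)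

/-- The upper Hamiltonian, as a graph. -/
def HUpper (κ : ℝ) (𝓔 : X → EReal) (S : ℝ → X → X) : Set ((X → ℝ) × (X → EReal)) :=
  {p | ∃ a b c : ℝ, ∃ μ ρ : X, 0 < a ∧ 0 < b ∧ 𝓔 ρ < ⊤ ∧
    p = (fUpper κ S a b c μ ρ, gUpper κ 𝓔 a b ρ)}

/-- The test functions of the lower Hamiltonian. -/
def fLower (κ : ℝ) (S : ℝ → X → X) (a b c : ℝ) (π γ : X) (μ : X) : ℝ :=
  -(1 / 2 * a * dist γ μ ^ 2) - b * tataruDist κ S μ π + c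

/-- The image of `fLower` under the lower Hamiltonian, with values in `(-∞, +∞]`. -/
def gLower (κ : ℝ) (𝓔 : X → EReal) (a b : ℝ) (γ : X) (μ : X) : EReal :=
  (a : EReal) * (𝓔 μ - 𝓔 γ) +
    ((a * (κ / 2) * dist γ μ ^ 2 - b + 1 / 2 * a ^ 2 * dist γ μ ^ 2 - a * b * dist γ μ
      - 1 / 2 * b ^ 2 : ℝ) : EReal)

/-- The lower Hamiltonian, as a graph. -/
def HLower (κ : ℝ) (𝓔 : X → EReal) (S : ℝ → X → X) : Set ((X → ℝ) × (X → EReal)) :=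
  {p | ∃ a b c : ℝ, ∃ π γ : X, 0 < a ∧ 0 < b ∧ 𝓔 γ < ⊤ ∧
    p = (fLower κ S a b c π γ, gLower κ 𝓔 a b γ)}

/-- `u` is a viscosity subsolution of `f - lam • A f = h`: it is bounded, upper semicontinuous, and
every test pair has a maximizing sequence of `u - f` along which the inequality holds
asymptotically. -/
structure IsSubsolution (lam : ℝ) (A : Set ((X → ℝ) × (X → EReal))) (h : X → ℝ) (u : X → ℝ) :
    Prop where
  bounded : ∃ C : ℝ, ∀ x, |u x| ≤ C
  usc : UpperSemicontinuous u
  exists_seq : ∀ f g, (f, g) ∈ A → ∃ x : ℕ → X,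
    Tendsto (fun n => ((u (x n) - f (x n) : ℝ) : EReal)) atTop
      (𝓝 (⨆ y, ((u y - f y : ℝ) : EReal))) ∧
    limsup (fun n => (u (x n) : EReal) - (lam : EReal) * g (x n) - (h (x n) : EReal)) atTop ≤ 0

/-- `v` is a viscosity supersolution of `f - lam • A f = h`. -/
structure IsSupersolution (lam : ℝ) (A : Set ((X → ℝ) × (X → EReal))) (h : X → ℝ) (v : X → ℝ) :
    Prop where
  bounded : ∃ C : ℝ, ∀ x, |v x| ≤ C
  lsc : LowerSemicontinuous v
  exists_seq : ∀ f g, (f, g) ∈ A → ∃ x : ℕ → X,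
    Tendsto (fun n => ((v (x n) - f (x n) : ℝ) : EReal)) atTop
      (𝓝 (⨅ y, ((v y - f y : ℝ) : EReal))) ∧
    0 ≤ liminf (fun n => (v (x n) : EReal) - (lam : EReal) * g (x n) - (h (x n) : EReal)) atTop

end EVIComparison

end

namespace EVIComparison

variable {X : Type*} [MetricSpace X] {κ : ℝ} {𝓔 : X → EReal} {S : ℝ → X → X}

/-! Variables are tripled: `u p - v m` is penalized by `a/2 (d(p,q)² + d(q,m)²)` and `b (T p + T
m)`, with `T` the Tataru distance to a fixed point. The middle point `q` is the base point of both
test functions, so it needs finite energy. Subtracting the two viscosity inequalities leaves `a (2 𝓔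
q - 𝓔 p - 𝓔 m)`, the term `a²/2 (d(p,q)² - d(q,m)²)` and small errors. Both terms are controlled by
the midpoint `z` of `p` and `m`. Replacing `q` by `z` can only lower the quadratic penalty, so
near-maximality makes `d(p,q)` and `d(q,m)` almost equal (`abs_dist_sub_dist_le`). As `z` is again
admissible and `q` has almost least energy (`IsEVIFlow.exists_near_min_energy`), `𝓔 q` is at most
about `𝓔 z`, which `κ`-convexity bounds (`IsEVIFlow.midpoint_convex`). -/

lemma IsEnergy.coe_toReal (h𝓔 : IsEnergy 𝓔) {x : X} (hx : 𝓔 x < ⊤) :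
    ((𝓔 x).toReal : EReal) = 𝓔 x :=
  EReal.coe_toReal hx.ne (h𝓔.ne_bot x)

/-! ### Consequences of the evolution variational inequality -/

lemma IsEVISolution.eventually_slope_lt {c : ℝ → X} (hc : IsEVISolution κ 𝓔 c) {ρ : X}
    (hρ : 𝓔 ρ < ⊤) {t : ℝ} (ht : 0 ≤ t) {K : ℝ}
    (hK : 𝓔 ρ - 𝓔 (c t) - ((κ / 2 * dist (c t) ρ ^ 2 : ℝ) : EReal) < ((K / 2 : ℝ) : EReal)) :
    ∀ᶠ s in 𝓝[>] (0 : ℝ), (dist (c (t + s)) ρ ^ 2 - dist (c t) ρ ^ 2) / s < K := by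
  have hD : upperRightDeriv (fun r => dist (c r) ρ ^ 2) t < (K : EReal) := by
    by_contra! hlt
    have h1 : ((1 / 2 : ℝ) : EReal) * (K : EReal) ≤
        ((1 / 2 : ℝ) : EReal) * upperRightDeriv (fun r => dist (c r) ρ ^ 2) t :=
      mul_le_mul_of_nonneg_left hlt (by exact_mod_cast (by norm_num : (0 : ℝ) ≤ 1 / 2))
    have h2 := (h1.trans (hc.evi ρ hρ t ht)).trans_lt hK
    rw [← EReal.coe_mul, EReal.coe_lt_coe_iff] at h2
    linarith
  filter_upwards [eventually_lt_of_limsup_lt hD] with s hs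
  exact_mod_cast hs

/-- Along the flow, the squared distance to the end points of a geodesic cannot decrease for both
of them when the flow starts from the midpoint. -/
lemma IsEVIFlow.not_midpoint_descent (hS : IsEVIFlow κ 𝓔 S) {p m z : X} (hp : 𝓔 p < ⊤)
    (hm : 𝓔 m < ⊤) (hzp : dist z p = dist p m / 2) (hzm : dist z m = dist p m / 2) {K L : ℝ}
    (hKL : K + L ≤ 0)
    (hK : 𝓔 p - 𝓔 z - ((κ / 2 * dist z p ^ 2 : ℝ) : EReal) < ((K / 2 : ℝ) : EReal))
    (hL : 𝓔 m - 𝓔 z - ((κ / 2 * dist z m ^ 2 : ℝ) : EReal) < ((L / 2 : ℝ) : EReal)) : False := by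
  have hc := hS.isSolution z
  have h0 : S 0 z = z := hS.map_zero z
  have e1 := hc.eventually_slope_lt hp le_rfl (K := K) (by simpa only [h0] using hK)
  have e2 := hc.eventually_slope_lt hm le_rfl (K := L) (by simpa only [h0] using hL)
  obtain ⟨s, ⟨h1, h2⟩, hs⟩ := ((e1.and e2).and self_mem_nhdsWithin).exists
  have hs : 0 < s := hs
  rw [div_lt_iff₀ hs] at h1 h2
  simp only [h0, hzp, hzm, zero_add] at h1 h2
  -- The squared distances to `p` and `m` sum to at least `d(p,m)²/2` everywhere, with equality at
  -- `z`; the two slope bounds would push the sum strictly below.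
  have htri := dist_triangle_left p m (S s z)
  have hd := dist_nonneg (x := p) (y := m)
  nlinarith [sq_nonneg (dist (S s z) p - dist (S s z) m), mul_nonpos_of_nonpos_of_nonneg hKL hs.le]

/-- The energy is `κ`-convex at midpoints. -/
lemma IsEVIFlow.midpoint_convex (h𝓔 : IsEnergy 𝓔) (hS : IsEVIFlow κ 𝓔 S) {p m z : X}
    (hp : 𝓔 p < ⊤) (hm : 𝓔 m < ⊤) (hzp : dist z p = dist p m / 2)
    (hzm : dist z m = dist p m / 2) :
    𝓔 z < ⊤ ∧ 2 * (𝓔 z).toReal ≤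
      (𝓔 p).toReal + (𝓔 m).toReal - κ / 4 * dist p m ^ 2 := by
  have hz : 𝓔 z < ⊤ := by
    by_contra hz
    have hz : 𝓔 z = ⊤ := not_lt_top_iff.1 hz
    -- At infinite energy the right-hand side of the EVI at time `0` is `-∞`.
    refine hS.not_midpoint_descent hp hm hzp hzm (K := 0) (L := 0) (by norm_num) ?_ ?_ <;>
    · rw [hz, EReal.sub_top, EReal.bot_sub]
      exact EReal.bot_lt_coe _
  refine ⟨hz, ?_⟩
  by_contra! hlt
  -- With this `K` and `L = -K`, both slope conditions become the negated convexity inequality.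
  set K := (𝓔 p).toReal - (𝓔 m).toReal with hKdef
  refine hS.not_midpoint_descent hp hm hzp hzm (K := K) (L := -K) (by linarith) ?_ ?_
  · rw [← h𝓔.coe_toReal hp, ← h𝓔.coe_toReal hz, ← EReal.coe_sub, ← EReal.coe_sub,
      EReal.coe_lt_coe_iff, hzp]
    nlinarith
  · rw [← h𝓔.coe_toReal hm, ← h𝓔.coe_toReal hz, ← EReal.coe_sub, ← EReal.coe_sub,
      EReal.coe_lt_coe_iff, hzm]
    nlinarith

/-- The flow enters the domain at once and is continuous at time `0`. -/
lemma IsEVIFlow.dense_effDomain (hS : IsEVIFlow κ 𝓔 S) : Dense (effDomain 𝓔) := by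
  intro x
  have hc := (hS.isSolution x).continuousOn 0 (by simp)
  have ht : Tendsto (fun t => S t x) (𝓝[>] 0) (𝓝 x) := by
    have := hc.tendsto.mono_left (nhdsWithin_mono 0 Ioi_subset_Ici_self)
    simpa only [hS.map_zero x] using this
  refine mem_closure_of_tendsto ht ?_
  filter_upwards [self_mem_nhdsWithin] with t ht
  exact (hS.isSolution x).mem_domain t ht

lemma IsEVISolution.sq_dist_le {c : ℝ → X} (hc : IsEVISolution κ 𝓔 c) {ρ : X} (hρ : 𝓔 ρ < ⊤)
    {K : ℝ} (hK : ∀ t ∈ Ico (0 : ℝ) 1,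
      𝓔 ρ - 𝓔 (c t) - ((κ / 2 * dist (c t) ρ ^ 2 : ℝ) : EReal) ≤ ((K / 2 : ℝ) : EReal)) :
    dist (c 1) ρ ^ 2 ≤ dist (c 0) ρ ^ 2 + K := by
  have hcont : ContinuousOn (fun t => dist (c t) ρ ^ 2) (Icc 0 1) :=
    ((continuous_id.dist continuous_const).pow 2).comp_continuousOn
      (hc.continuousOn.mono Icc_subset_Ici_self)
  have := image_le_of_liminf_slope_right_le_deriv_boundary hcont
    (B := fun t => dist (c 0) ρ ^ 2 + K * t) (B' := fun _ => K) (by simp) (by fun_prop)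
    (fun x _ => by
      simpa using (((hasDerivAt_id x).const_mul K).const_add (dist (c 0) ρ ^ 2)).hasDerivWithinAt)
    (fun t ht r hr => by
      have hlt := (hK t ht).trans_lt (EReal.coe_lt_coe_iff.2 (by linarith : K / 2 < r / 2))
      have he := hc.eventually_slope_lt hρ ht.1 hlt
      have hmap : Tendsto (fun z => z - t) (𝓝[>] t) (𝓝[>] 0) := by
        refine tendsto_nhdsWithin_iff.2 ⟨?_, ?_⟩
        · have : Tendsto (fun z => z - t) (𝓝 t) (𝓝 (t - t)) :=
            (continuous_id.sub continuous_const).tendsto t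
          rw [sub_self] at this
          exact this.mono_left nhdsWithin_le_nhds
        · filter_upwards [self_mem_nhdsWithin] with z hz
          exact mem_Ioi.2 (sub_pos.2 (mem_Ioi.1 hz))
      refine (hmap.eventually he).frequently.mono fun z hz => ?_
      simpa [slope_def_field] using hz)
    (right_mem_Icc.2 zero_le_one)
  simpa using this

/-- The energy is bounded below on bounded sets. -/
lemma IsEVIFlow.bddBelow_energy (h𝓔 : IsEnergy 𝓔) (hS : IsEVIFlow κ 𝓔 S) (x₀ : X) (R : ℝ) :
    ∃ m : ℝ, ∀ ρ, 𝓔 ρ < ⊤ → dist ρ x₀ ≤ R → m ≤ (𝓔 ρ).toReal := by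
  have hc := hS.isSolution x₀
  have hcomp : IsCompact ((fun t => S t x₀) '' Icc 0 1) :=
    isCompact_Icc.image_of_continuousOn (hc.continuousOn.mono Icc_subset_Ici_self)
  obtain ⟨q, hq, hmin⟩ := LowerSemicontinuousOn.exists_isMinOn
    ((nonempty_Icc.2 (zero_le_one (α := ℝ))).image _) hcomp (h𝓔.lsc.lowerSemicontinuousOn _)
  have hmin : ∀ t ∈ Icc (0 : ℝ) 1, 𝓔 q ≤ 𝓔 (S t x₀) := fun t ht => hmin (mem_image_of_mem _ ht)
  have hqtop : 𝓔 q < ⊤ :=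
    (hmin 1 (right_mem_Icc.2 zero_le_one)).trans_lt (hc.mem_domain 1 one_pos)
  obtain ⟨D, hD⟩ := hcomp.isBounded.subset_closedBall x₀
  have hD : ∀ t ∈ Icc (0 : ℝ) 1, dist (S t x₀) x₀ ≤ D := fun t ht =>
    hD (mem_image_of_mem (fun t => S t x₀) ht)
  have hRD : ∀ ρ, dist ρ x₀ ≤ R → ∀ t ∈ Icc (0 : ℝ) 1, dist (S t x₀) ρ ^ 2 ≤ (D + R) ^ 2 :=
    fun ρ hρ t ht => pow_le_pow_left₀ dist_nonneg
      ((dist_triangle_right _ _ x₀).trans (add_le_add (hD t ht) hρ)) 2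
  -- Integrating the EVI over `[0, 1]`, a very negative `𝓔 ρ` would decrease `d²(S t x₀, ρ)` by more
  -- than its initial value, at most `(D + R)²`.
  refine ⟨(𝓔 q).toReal - |κ| / 2 * (D + R) ^ 2 - (D + R) ^ 2 / 2, fun ρ hρ hρR => ?_⟩
  have key := hc.sq_dist_le hρ
    (K := 2 * ((𝓔 ρ).toReal - (𝓔 q).toReal + |κ| / 2 * (D + R) ^ 2)) fun t ht => by
      have htt : t ∈ Icc (0 : ℝ) 1 := Ico_subset_Icc_self ht
      rw [show 2 * ((𝓔 ρ).toReal - (𝓔 q).toReal + |κ| / 2 * (D + R) ^ 2) / 2 =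
        (𝓔 ρ).toReal - (𝓔 q).toReal - (-(|κ| / 2 * (D + R) ^ 2)) by ring, EReal.coe_sub,
        EReal.coe_sub, h𝓔.coe_toReal hρ, h𝓔.coe_toReal hqtop]
      refine EReal.sub_le_sub (EReal.sub_le_sub le_rfl (hmin t htt)) (EReal.coe_le_coe_iff.2 ?_)
      nlinarith [neg_abs_le κ, abs_nonneg κ, hRD ρ hρR t htt, sq_nonneg (dist (S t x₀) ρ)]
  have h0 := hRD ρ hρR 0 (left_mem_Icc.2 zero_le_one)
  nlinarith [sq_nonneg (dist (S 1 x₀) ρ)]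

lemma tataruDist_nonneg (x y : X) : 0 ≤ tataruDist κ S x y :=
  Real.iInf_nonneg fun _ => by positivity

/-- Balls of the Tataru distance are bounded. -/
lemma IsEVIFlow.dist_le_of_tataruDist_lt (hS : IsEVIFlow κ 𝓔 S) (x₀ : X) (r : ℝ) :
    ∃ R : ℝ, ∀ x, tataruDist κ S x x₀ < r → dist x x₀ ≤ R := by
  have hcomp : IsCompact ((fun t => S t x₀) '' Icc 0 r) :=
    isCompact_Icc.image_of_continuousOn
      ((hS.isSolution x₀).continuousOn.mono Icc_subset_Ici_self)
  obtain ⟨D, hD⟩ := hcomp.isBounded.subset_closedBall x₀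
  -- A competitor below `r` uses a time `t ≤ r`, so `x` is close to a compact arc of the flow.
  refine ⟨r * Real.exp (-(min 0 κ) * r) + D, fun x hx => ?_⟩
  obtain ⟨t, ht⟩ := exists_lt_of_ciInf_lt hx
  have hd := dist_nonneg (x := x) (y := S t x₀)
  have he := Real.exp_pos (min 0 κ * t)
  have htr : (t : ℝ) ≤ r := by nlinarith
  have hDt : dist (S t x₀) x₀ ≤ D :=
    hD (mem_image_of_mem (fun t => S t x₀) (⟨t.2, htr⟩ : (t : ℝ) ∈ Icc 0 r))
  have hexp : Real.exp (min 0 κ * r) ≤ Real.exp (min 0 κ * t) :=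
    Real.exp_le_exp.2 (mul_le_mul_of_nonpos_left htr (min_le_left _ _))
  have h1 : Real.exp (min 0 κ * r) * dist x (S t x₀) ≤ r := by
    have := mul_le_mul_of_nonneg_right hexp hd
    linarith [t.2]
  have h2 : dist x (S t x₀) ≤ r * Real.exp (-(min 0 κ) * r) := by
    rw [neg_mul, Real.exp_neg, ← div_eq_mul_inv, le_div_iff₀ (Real.exp_pos _)]
    linarith
  linarith [dist_triangle x (S t x₀) x₀]

/-! ### Viscosity inequalities at near-optimal points -/

variable {lam : ℝ} {h u v : X → ℝ}

/-- The use of a subsolution: a test function is nearly maximized at a point of finite energy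
where the differential inequality nearly holds. -/
lemma IsSubsolution.exists_near_max (h𝓔 : IsEnergy 𝓔) (hlam : 0 < lam)
    (hu : IsSubsolution lam (HUpper κ 𝓔 S) h u) {a b : ℝ} (ha : 0 < a) (hb : 0 < b) (μ : X)
    {ρ : X} (hρ : 𝓔 ρ < ⊤) (y : X) {η : ℝ} (hη : 0 < η) :
    ∃ x, 𝓔 x < ⊤ ∧ u y - fUpper κ S a b 0 μ ρ y - η < u x - fUpper κ S a b 0 μ ρ x ∧
      u x ≤ h x + η + lam * (a * ((𝓔 ρ).toReal - (𝓔 x).toReal) +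
        (-(a * (κ / 2) * dist x ρ ^ 2) + b + 1 / 2 * a ^ 2 * dist x ρ ^ 2 + a * b * dist x ρ
          + 1 / 2 * b ^ 2)) := by
  obtain ⟨x, hx, hlim⟩ := hu.exists_seq _ _ ⟨a, b, 0, μ, ρ, ha, hb, hρ, rfl⟩
  have h1 : ((u y - fUpper κ S a b 0 μ ρ y - η : ℝ) : EReal) <
      ⨆ y, ((u y - fUpper κ S a b 0 μ ρ y : ℝ) : EReal) :=
    (EReal.coe_lt_coe_iff.2 (by linarith)).trans_le
      (le_iSup (fun y => ((u y - fUpper κ S a b 0 μ ρ y : ℝ) : EReal)) y)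
  have e1 := hx.eventually_const_lt h1
  have e2 := eventually_lt_of_limsup_lt (hlim.trans_lt (EReal.coe_pos.2 hη))
  obtain ⟨n, h1, h2⟩ := (e1.and e2).exists
  -- At infinite energy `gUpper` is `-∞`, so the left-hand side of the subsolution inequality is
  -- `+∞`.
  have hn : 𝓔 (x n) < ⊤ := by
    by_contra hn
    rw [gUpper, not_lt_top_iff.1 hn, EReal.sub_top, EReal.coe_mul_bot_of_pos ha, EReal.bot_add,
      EReal.coe_mul_bot_of_pos hlam, EReal.coe_sub_bot, EReal.top_sub_coe] at h2
    exact not_top_lt h2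
  refine ⟨x n, hn, EReal.coe_lt_coe_iff.1 h1, ?_⟩
  rw [gUpper, ← h𝓔.coe_toReal hn, ← h𝓔.coe_toReal hρ] at h2
  have h3 := EReal.coe_lt_coe_iff.1 (by exact_mod_cast h2)
  linarith

/-- The use of a supersolution: a test function is nearly minimized at a point of finite energy
where the differential inequality nearly holds. -/
lemma IsSupersolution.exists_near_min (h𝓔 : IsEnergy 𝓔) (hlam : 0 < lam)
    (hv : IsSupersolution lam (HLower κ 𝓔 S) h v) {a b : ℝ} (ha : 0 < a) (hb : 0 < b) (π : X)
    {γ : X} (hγ : 𝓔 γ < ⊤) (y : X) {η : ℝ} (hη : 0 < η) :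
    ∃ x, 𝓔 x < ⊤ ∧ v x - fLower κ S a b 0 π γ x < v y - fLower κ S a b 0 π γ y + η ∧
      h x - η + lam * (a * ((𝓔 x).toReal - (𝓔 γ).toReal) +
        (a * (κ / 2) * dist γ x ^ 2 - b + 1 / 2 * a ^ 2 * dist γ x ^ 2 - a * b * dist γ x
          - 1 / 2 * b ^ 2)) ≤ v x := by
  obtain ⟨x, hx, hlim⟩ := hv.exists_seq _ _ ⟨a, b, 0, π, γ, ha, hb, hγ, rfl⟩
  have h1 : (⨅ y, ((v y - fLower κ S a b 0 π γ y : ℝ) : EReal)) <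
      ((v y - fLower κ S a b 0 π γ y + η : ℝ) : EReal) :=
    (iInf_le (fun y => ((v y - fLower κ S a b 0 π γ y : ℝ) : EReal)) y).trans_lt
      (EReal.coe_lt_coe_iff.2 (by linarith))
  have e1 := hx.eventually_lt_const h1
  have e2 := eventually_lt_of_lt_liminf
    ((EReal.coe_lt_coe_iff.2 (neg_lt_zero.2 hη)).trans_le hlim)
  obtain ⟨n, h1, h2⟩ := (e1.and e2).exists
  have hn : 𝓔 (x n) < ⊤ := by
    by_contra hn
    rw [gLower, not_lt_top_iff.1 hn, ← h𝓔.coe_toReal hγ, EReal.top_sub_coe,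
      EReal.coe_mul_top_of_pos ha, EReal.top_add_coe,
      EReal.coe_mul_top_of_pos hlam, EReal.sub_top, EReal.bot_sub] at h2
    exact not_lt_bot h2
  refine ⟨x n, hn, EReal.coe_lt_coe_iff.1 h1, ?_⟩
  rw [gLower, ← h𝓔.coe_toReal hn, ← h𝓔.coe_toReal hγ] at h2
  have h3 := EReal.coe_lt_coe_iff.1 (by exact_mod_cast h2)
  linarith

/-! ### Penalization and near-maximizers -/

/-- The difference `u p - v m`, penalized by the distances of `p` and `m` to a third point `r` and
by a confining function `T`. -/
noncomputable def penalized (T u v : X → ℝ) (a b : ℝ) (p r m : X) : ℝ :=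
  u p - v m - b * (T p + T m) - a / 2 * (dist p r ^ 2 + dist r m ^ 2)

/-- The penalization parameters can be chosen such that the penalization is negligible at all
near-maximizers. -/
lemma exists_penalization [Nonempty X] {T u v : X → ℝ} (hT : ∀ x, 0 ≤ T x) {C D : ℝ}
    (hu : ∀ x, |u x| ≤ C) (hv : ∀ x, |v x| ≤ D) {ε : ℝ} (hε : 0 < ε) {A : ℝ} (hA : 0 < A) :
    ∃ a b N : ℝ, A ≤ a ∧ 0 < b ∧ b ≤ ε / a ∧ (∀ p r m, penalized T u v a b p r m ≤ N) ∧
      (∀ δ > 0, ∃ p r m, N - δ < penalized T u v a b p r m) ∧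
      (∀ x, u x - v x ≤ N + 2 * ε) ∧
      ∀ p r m, N - ε < penalized T u v a b p r m →
        a * (dist p r ^ 2 + dist r m ^ 2) ≤ 16 * ε := by
  let F : ℝ → ℝ → X × X × X → ℝ := fun a b z => penalized T u v a b z.1 z.2.1 z.2.2
  have hF : ∀ a b, 0 ≤ a → 0 ≤ b → ∀ z, F a b z ≤ C + D := fun a b ha hb z => by
    have h1 := (abs_le.1 (hu z.1)).2
    have h2 := (abs_le.1 (hv z.2.2)).1
    have h3 : 0 ≤ b * (T z.1 + T z.2.2) := mul_nonneg hb (add_nonneg (hT _) (hT _))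
    have h4 : 0 ≤ a / 2 * (dist z.1 z.2.1 ^ 2 + dist z.2.1 z.2.2 ^ 2) := by positivity
    simp only [F, penalized]
    linarith
  have hbdd : ∀ a b, 0 ≤ a → 0 ≤ b → BddAbove (range (F a b)) := fun a b ha hb =>
    ⟨C + D, forall_mem_range.2 (hF a b ha hb)⟩
  let N : ℝ → ℝ → ℝ := fun a b => ⨆ z, F a b z
  have hle : ∀ a b, 0 ≤ a → 0 ≤ b → ∀ z, F a b z ≤ N a b := fun a b ha hb z =>
    le_ciSup (hbdd a b ha hb) z
  have hdiag : ∀ a, 0 ≤ a → ∀ x, u x - v x ≤ N a 0 := fun a ha x => by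
    simpa [F, penalized] using hle a 0 ha le_rfl (x, x, x)
  obtain ⟨x₀⟩ := ‹Nonempty X›
  -- Taking `a₁` almost minimizing for `N · 0` on `[A, ∞)` ensures that doubling it lowers the
  -- supremum by less than `ε`.
  obtain ⟨a₁, ha₁, hlt⟩ : ∃ a₁, A ≤ a₁ ∧ N a₁ 0 - ε < N (2 * a₁) 0 := by
    have hbelow : BddBelow ((fun a => N a 0) '' Ici A) := by
      refine ⟨u x₀ - v x₀, forall_mem_image.2 fun a ha => hdiag a (hA.le.trans ha) x₀⟩
    obtain ⟨_, ⟨a₁, ha₁, rfl⟩, h1⟩ :=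
      Real.lt_sInf_add_pos ((nonempty_Ici (a := A)).image fun a => N a 0) hε
    have ha₁ : A ≤ a₁ := ha₁
    have h2 := csInf_le hbelow (mem_image_of_mem (fun a => N a 0)
      (show 2 * a₁ ∈ Ici A from mem_Ici.2 (by linarith)))
    exact ⟨a₁, ha₁, by simp only at h1 h2; linarith⟩
  have ha₁0 : 0 < a₁ := hA.trans_le ha₁
  have ha : 0 < 2 * a₁ := by linarith
  obtain ⟨z, hz⟩ := exists_lt_of_lt_ciSup (show N (2 * a₁) 0 - ε < N (2 * a₁) 0 by linarith)
  have hTz : 0 ≤ T z.1 + T z.2.2 := add_nonneg (hT _) (hT _)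
  obtain ⟨b, hb, hba, hbT⟩ : ∃ b > 0, b ≤ ε / (2 * a₁) ∧ b * (T z.1 + T z.2.2) ≤ ε := by
    -- The `+ 1` keeps the denominator positive when `T` vanishes at both points.
    refine ⟨min (ε / (2 * a₁)) (ε / (T z.1 + T z.2.2 + 1)), by positivity, min_le_left _ _, ?_⟩
    calc _ ≤ ε / (T z.1 + T z.2.2 + 1) * (T z.1 + T z.2.2 + 1) :=
          mul_le_mul (min_le_right _ _) (by linarith) hTz (by positivity)
      _ = ε := div_mul_cancel₀ _ (by positivity)
  have hN : N (2 * a₁) 0 - 2 * ε < N (2 * a₁) b := by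
    refine lt_of_lt_of_le ?_ (hle (2 * a₁) b ha.le hb.le z)
    simp only [F, penalized] at hz ⊢
    linarith
  refine ⟨2 * a₁, b, N (2 * a₁) b, by linarith, hb, hba,
    fun p r m => hle _ _ ha.le hb.le (p, r, m), fun δ hδ => ?_,
    fun x => by linarith [hdiag (2 * a₁) ha.le x], fun p r m hp => ?_⟩
  · obtain ⟨z, hz⟩ := exists_lt_of_lt_ciSup
      (show N (2 * a₁) b - δ < N (2 * a₁) b by linarith)
    exact ⟨_, _, _, hz⟩
  -- Halving `a` and dropping `b` gains at least `a₁/2` times the sum of squares, yet less than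
  -- `4ε`; as `a = 2 a₁`, this gives `16ε`.
  · have h1 := hle a₁ 0 ha₁0.le le_rfl (p, r, m)
    have h2 : 0 ≤ b * (T p + T m) := mul_nonneg hb.le (add_nonneg (hT _) (hT _))
    simp only [F] at h1
    simp only [penalized] at h1 hp
    linarith

/-- An approximate maximizer of the penalized difference cannot be far from a midpoint. -/
lemma abs_dist_sub_dist_le {T u v : X → ℝ} {a b N δ : ℝ} (ha : 1 ≤ a) {p r m z : X}
    (hzp : dist p z = dist p m / 2) (hzm : dist z m = dist p m / 2)
    (hN : penalized T u v a b p z m ≤ N) (hδ : N - δ ^ 2 < penalized T u v a b p r m)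
    (hδ0 : 0 ≤ δ) :
    N - δ ^ 2 < penalized T u v a b p z m ∧ |dist p r - dist r m| ≤ 2 * δ := by
  have hd := dist_nonneg (x := p) (y := m)
  have htri := dist_triangle p r m
  have hsq : dist p m ^ 2 ≤ (dist p r + dist r m) ^ 2 := pow_le_pow_left₀ hd htri 2
  -- Passing to `z` raises the penalized value by at least `a/4 (d(p,r) - d(r,m))²`, while less than
  -- `δ²` is available.
  have hpar : dist p z ^ 2 + dist z m ^ 2 ≤
      dist p r ^ 2 + dist r m ^ 2 - (dist p r - dist r m) ^ 2 / 2 := by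
    rw [hzp, hzm]; nlinarith
  have hmul := mul_le_mul_of_nonneg_left hpar (by linarith : 0 ≤ a / 2)
  have hge : (dist p r - dist r m) ^ 2 / 4 ≤ a / 2 * ((dist p r - dist r m) ^ 2 / 2) := by
    nlinarith [sq_nonneg (dist p r - dist r m)]
  simp only [penalized] at *
  have h0 := sq_nonneg (dist p r - dist r m)
  refine ⟨by linarith, abs_le_of_sq_le_sq (by nlinarith) (by linarith)⟩

/-- Among the points of finite energy at which the penalized difference is nearly maximal there is
one of nearly minimal energy. -/
lemma IsEVIFlow.exists_near_min_energy (h𝓔 : IsEnergy 𝓔) (hS : IsEVIFlow κ 𝓔 S) (x₀ : X)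
    {u v : X → ℝ} {C D a b N δ ε : ℝ} (hC : ∀ x, |u x| ≤ C) (hD : ∀ x, |v x| ≤ D) (ha : 0 < a)
    (hb : 0 < b)
    (hNex : ∃ p q m, N - δ < penalized (fun y => tataruDist κ S y x₀) u v a b p q m)
    (hpen : ∀ p q m, N - δ < penalized (fun y => tataruDist κ S y x₀) u v a b p q m →
      dist p q ^ 2 + dist q m ^ 2 ≤ 16) (hε : 0 < ε) :
    ∃ q ∈ {q | 𝓔 q < ⊤ ∧
        ∃ p m, N - δ < penalized (fun y => tataruDist κ S y x₀) u v a b p q m},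
      ∀ z ∈ {q | 𝓔 q < ⊤ ∧
        ∃ p m, N - δ < penalized (fun y => tataruDist κ S y x₀) u v a b p q m},
      (𝓔 q).toReal ≤ (𝓔 z).toReal + ε := by
  set T : X → ℝ := fun y => tataruDist κ S y x₀ with hTdef
  have hT : ∀ y, 0 ≤ T y := fun y => tataruDist_nonneg y x₀
  let K : Set X := {q | 𝓔 q < ⊤ ∧ ∃ p m, N - δ < penalized T u v a b p q m}
  have hKne : K.Nonempty := by
    obtain ⟨p, q, m, hpqm⟩ := hNex
    -- The penalized value is continuous in the middle point, so a near-maximizer can be moved into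
    -- the dense domain.
    have hopen : IsOpen {y | N - δ < penalized T u v a b p y m} :=
      isOpen_lt continuous_const (by unfold penalized; fun_prop)
    obtain ⟨y, hy, hyD⟩ := hS.dense_effDomain.inter_open_nonempty _ hopen ⟨q, hpqm⟩
    exact ⟨y, hyD, p, m, hy⟩
  -- Near-maximality bounds `T p`, hence `p`, hence the nearby `q`; the energy is bounded below
  -- there.
  obtain ⟨L, hL⟩ : ∃ L : ℝ, ∀ q ∈ K, L ≤ (𝓔 q).toReal := by
    obtain ⟨R, hR⟩ := hS.dist_le_of_tataruDist_lt x₀ ((C + D - N + δ) / b + 1)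
    obtain ⟨L, hL⟩ := hS.bddBelow_energy h𝓔 x₀ (R + 4)
    refine ⟨L, fun q ⟨hq, p, m, hpm⟩ => hL q hq ?_⟩
    have h16 := hpen p q m hpm
    have hpq : dist p q ≤ 4 := by
      refine abs_le_of_sq_le_sq' ?_ (by norm_num) |>.2
      linarith [sq_nonneg (dist q m)]
    have hTp : T p < (C + D - N + δ) / b + 1 := by
      have : T p ≤ (C + D - N + δ) / b := by
        rw [le_div_iff₀ hb]
        simp only [penalized] at hpm
        have h4 : 0 ≤ a / 2 * (dist p q ^ 2 + dist q m ^ 2) := by positivity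
        nlinarith [(abs_le.1 (hC p)).2, (abs_le.1 (hD m)).1, mul_nonneg hb.le (hT m)]
      linarith
    linarith [dist_triangle q p x₀, dist_comm q p, hR p hTp]
  obtain ⟨_, ⟨q, hq, rfl⟩, hlt⟩ :=
    Real.lt_sInf_add_pos (hKne.image fun q => (𝓔 q).toReal) hε
  refine ⟨q, hq, fun z hz => hlt.le.trans (by
    gcongr
    exact csInf_le ⟨L, forall_mem_image.2 hL⟩ (mem_image_of_mem (fun q => (𝓔 q).toReal) hz))⟩

/-- The numbers `33` and `6` come from `a d² ≤ 32 < 33 ≤ a r²` and `(s + t)² ≤ 32 < 36`. -/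
lemma lt_of_mul_sq_le {a ε r s t d : ℝ} (ha : 1 ≤ a) (hε : ε ≤ 1) (hr : 0 < r)
    (har : 33 ≤ a * r ^ 2) (hd : 0 ≤ d) (hdst : d ≤ s + t)
    (h16 : a * (s ^ 2 + t ^ 2) ≤ 16 * ε) :
    d ^ 2 ≤ 2 * (s ^ 2 + t ^ 2) ∧ s + t ≤ 6 ∧ d < r := by
  have hsum : (s + t) ^ 2 ≤ 2 * (s ^ 2 + t ^ 2) := by linarith [sq_nonneg (s - t)]
  have hdsq : d ^ 2 ≤ 2 * (s ^ 2 + t ^ 2) := (pow_le_pow_left₀ hd hdst 2).trans hsum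
  have h1 : s ^ 2 + t ^ 2 ≤ a * (s ^ 2 + t ^ 2) := le_mul_of_one_le_left (by positivity) ha
  refine ⟨hdsq, (abs_le_of_sq_le_sq' (by linarith) (by norm_num)).2, lt_of_not_ge fun hrd => ?_⟩
  have h2 := mul_le_mul_of_nonneg_left ((pow_le_pow_left₀ hr.le hrd 2).trans hdsq)
    (by linarith : 0 ≤ a)
  linarith

/-- The elementary estimate of the difference of the two Hamiltonians at a near-maximizer. -/
lemma hamiltonian_sub_le {a b ε δ κ s t d e₀ e₁ e₂ : ℝ} (ha1 : 1 ≤ a) (hb : 0 < b) (hε : 0 < ε)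
    (hε1 : ε ≤ 1) (hab : a * b ≤ ε) (hbε : b ≤ ε) (hδa : a ^ 2 * δ ≤ ε) (hs0 : 0 ≤ s)
    (ht0 : 0 ≤ t) (hdsq : d ^ 2 ≤ 2 * (s ^ 2 + t ^ 2)) (hst : s + t ≤ 6)
    (habs : |s - t| ≤ 2 * δ) (h16 : a * (s ^ 2 + t ^ 2) ≤ 16 * ε)
    (henergy : 2 * e₀ - e₁ - e₂ ≤ 2 * (ε / a) - κ / 4 * d ^ 2) :
    a * (2 * e₀ - e₁ - e₂) - κ / 2 * (a * (s ^ 2 + t ^ 2)) + 2 * b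
      + a ^ 2 / 2 * (s ^ 2 - t ^ 2) + a * b * (s + t) + b ^ 2 ≤ (17 + 16 * |κ|) * ε := by
  have ha : 0 < a := by linarith
  have hδ0 : 0 ≤ δ := by linarith [abs_nonneg (s - t)]
  have hdiff : a ^ 2 / 2 * (s ^ 2 - t ^ 2) ≤ 6 * ε := by
    have h1 : (s - t) * (s + t) ≤ 2 * δ * 6 :=
      mul_le_mul ((le_abs_self _).trans habs) hst (by positivity) (by positivity)
    nlinarith [sq_nonneg a]
  have hen : a * (2 * e₀ - e₁ - e₂) ≤
      2 * ε - κ / 4 * (a * d ^ 2) := by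
    have h1 : 2 * e₀ - e₁ - e₂ ≤
        2 * (ε / a) - κ / 4 * d ^ 2 := henergy
    have h2 := mul_le_mul_of_nonneg_left h1 ha.le
    have h3 : a * (ε / a) = ε := mul_div_cancel₀ ε ha.ne'
    nlinarith
  have hκ : -(κ / 4 * (a * d ^ 2)) - κ / 2 * (a * (s ^ 2 + t ^ 2)) ≤ 16 * |κ| * ε := by
    have h1 : a * d ^ 2 ≤ 2 * (a * (s ^ 2 + t ^ 2)) := by nlinarith
    have h2 : 0 ≤ a * d ^ 2 / 4 + a * (s ^ 2 + t ^ 2) / 2 := by positivity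
    have h3 := mul_le_mul_of_nonneg_right (neg_abs_le κ) h2
    have h4 : |κ| * (a * d ^ 2 / 4 + a * (s ^ 2 + t ^ 2) / 2) ≤ |κ| * (16 * ε) :=
      mul_le_mul_of_nonneg_left (by linarith) (abs_nonneg κ)
    linarith
  have hbst : a * b * (s + t) ≤ 6 * ε := by
    have := mul_le_mul hab hst (by positivity) hε.le
    linarith
  have hb2 : b ^ 2 ≤ ε := by nlinarith
  -- The `17` is `2 + 2 + 6 + 6 + 1`: energy, `2 * b`, difference of squares, `a * b * (s + t)`, `b
  -- ^ 2`.
  linarith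

/-! ### The comparison estimate -/

/-- `u x - v x` exceeds the supremum of `h₁ - h₂` by at most a multiple of an arbitrarily small
number. The penalized difference couples `p` and `m` through a third point `q` of finite energy,
chosen with nearly minimal energy among the near-maximizers. The midpoint of `p` and `m` competes
with `q`, so the `κ`-convexity of the energy, a consequence of the evolution variational inequality,
controls `2 𝓔 q - 𝓔 p - 𝓔 m`. Hence neither regularized geodesics nor Ekeland's principle are
needed. -/
lemma IsSubsolution.sub_le (hX : IsGeodesicSpace X) (h𝓔 : IsEnergy 𝓔) (hS : IsEVIFlow κ 𝓔 S)
    {lam : ℝ} (hlam : 0 < lam) {h₁ h₂ u v : X → ℝ} (hh : UniformContinuous h₁)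
    (hu : IsSubsolution lam (HUpper κ 𝓔 S) h₁ u)
    (hv : IsSupersolution lam (HLower κ 𝓔 S) h₂ v) {H : ℝ} (hH : ∀ x, h₁ x - h₂ x ≤ H) (x : X)
    {ε : ℝ} (hε : 0 < ε) (hε1 : ε ≤ 1) :
    u x - v x ≤ H + (6 + lam * (17 + 16 * |κ|)) * ε := by
  obtain ⟨C, hC⟩ := hu.bounded
  obtain ⟨D, hD⟩ := hv.bounded
  obtain ⟨x₀, -⟩ := h𝓔.proper
  have : Nonempty X := ⟨x₀⟩
  obtain ⟨r, hr, hmod⟩ := Metric.uniformContinuous_iff.1 hh ε hε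
  set T : X → ℝ := fun y => tataruDist κ S y x₀ with hTdef
  have hT : ∀ y, 0 ≤ T y := fun y => tataruDist_nonneg y x₀
  obtain ⟨a, b, N, haA, hb, hba, hN, hNex, huv, hpen⟩ :=
    exists_penalization hT hC hD hε (A := 33 / r ^ 2 + 1) (by positivity)
  have ha1 : 1 ≤ a := by
    have : 0 < 33 / r ^ 2 := by positivity
    linarith
  have ha : 0 < a := by linarith
  have har : 33 ≤ a * r ^ 2 := by
    have : 33 / r ^ 2 ≤ a := by linarith
    rwa [div_le_iff₀ (by positivity)] at this
  have hab : a * b ≤ ε := by rw [le_div_iff₀ ha] at hba; linarith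
  have hbε : b ≤ ε := by nlinarith
  obtain ⟨δ, hδ, hδε, hδa⟩ : ∃ δ > 0, δ ^ 2 ≤ ε ∧ a ^ 2 * δ ≤ ε := by
    refine ⟨ε / a ^ 2, by positivity, ?_, by field_simp; exact le_rfl⟩
    have : ε / a ^ 2 ≤ ε := div_le_self hε.le (by nlinarith)
    have : 0 < ε / a ^ 2 := by positivity
    nlinarith
  obtain ⟨q, ⟨hqD, p₀, m₀, hpm₀⟩, hqmin⟩ := hS.exists_near_min_energy h𝓔 x₀ hC hD ha hb
    (hNex _ (pow_pos hδ 2))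
    (fun p q m hp => (le_mul_of_one_le_left (by positivity) ha1).trans
      ((hpen p q m (by linarith)).trans (by linarith : 16 * ε ≤ 16))) (div_pos hε ha)
  -- Replacing `p₀` by `p` and `m₀` by `m` costs at most `η` each, so `(p, q, m)` stays a
  -- near-maximizer with the same `q`.
  obtain ⟨η, hη, hηε, hη2⟩ : ∃ η > 0, η ≤ ε ∧
      2 * η ≤ penalized T u v a b p₀ q m₀ - (N - δ ^ 2) :=
    ⟨min ε ((penalized T u v a b p₀ q m₀ - (N - δ ^ 2)) / 2),
      lt_min hε (by linarith), min_le_left _ _, by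
        linarith [min_le_right ε ((penalized T u v a b p₀ q m₀ - (N - δ ^ 2)) / 2)]⟩
  obtain ⟨p, hpD, hp, hpH⟩ := hu.exists_near_max h𝓔 hlam ha hb x₀ hqD p₀ hη
  obtain ⟨m, hmD, hm, hmH⟩ := hv.exists_near_min h𝓔 hlam ha hb x₀ hqD m₀ hη
  have hpm : N - δ ^ 2 < penalized T u v a b p q m := by
    simp only [fUpper, fLower] at hp hm
    simp only [penalized, hTdef] at hη2 ⊢
    linarith
  obtain ⟨c, hc0, hc1, hc⟩ := hX p m
  have hzp : dist p (c (1 / 2)) = dist p m / 2 := by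
    have := hc 0 (by norm_num) (1 / 2) (by norm_num)
    rw [hc0] at this
    rw [this, abs_of_pos (by norm_num)]; ring
  have hzm : dist (c (1 / 2)) m = dist p m / 2 := by
    have := hc (1 / 2) (by norm_num) 1 (by norm_num)
    rw [hc1] at this
    rw [this, abs_of_pos (by norm_num)]; ring
  obtain ⟨hzD, hconv⟩ := hS.midpoint_convex h𝓔 hpD hmD ((dist_comm _ _).trans hzp) hzm
  obtain ⟨hz, habs⟩ := abs_dist_sub_dist_le ha1 hzp hzm (hN _ _ _) hpm hδ.le
  have hmin := hqmin _ ⟨hzD, p, m, hz⟩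
  have h16 := hpen p q m (by linarith)
  have hs0 := dist_nonneg (x := p) (y := q)
  have ht0 := dist_nonneg (x := q) (y := m)
  have hd0 := dist_nonneg (x := p) (y := m)
  have htri := dist_triangle p q m
  set s := dist p q
  set t := dist q m
  set d := dist p m
  obtain ⟨hdsq, hst, hdr⟩ := lt_of_mul_sq_le ha1 hε1 hr har hd0 htri h16
  have hmodpm : h₁ p - h₁ m ≤ ε := by
    have := hmod hdr
    rw [Real.dist_eq] at this
    exact (le_abs_self _).trans this.le
  have hfin : u p - v m ≤ h₁ p - h₂ m + 2 * η +
      lam * (a * (2 * (𝓔 q).toReal - (𝓔 p).toReal - (𝓔 m).toReal)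
        - κ / 2 * (a * (s ^ 2 + t ^ 2)) + 2 * b + a ^ 2 / 2 * (s ^ 2 - t ^ 2)
        + a * b * (s + t) + b ^ 2) := by
    linarith
  have hbr := mul_le_mul_of_nonneg_left (hamiltonian_sub_le (κ := κ) ha1 hb hε hε1 hab hbε hδa
    hs0 ht0 hdsq hst habs h16 (show 2 * (𝓔 q).toReal - (𝓔 p).toReal - (𝓔 m).toReal ≤
      2 * (ε / a) - κ / 4 * d ^ 2 by linarith)) hlam.le
  have hF : penalized T u v a b p q m ≤ u p - v m := by
    have h1 : 0 ≤ b * (T p + T m) := mul_nonneg hb.le (add_nonneg (hT _) (hT _))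
    have h2 : 0 ≤ a / 2 * (dist p q ^ 2 + dist q m ^ 2) := by positivity
    unfold penalized
    linarith
  -- The `6` collects `2ε` from `huv`, `δ² ≤ ε`, the modulus of `h₁`, and `2η ≤ 2ε`.
  linarith [huv x, hH m]

end EVIComparison

theorem theorem2p12 {X : Type*} [MetricSpace X] [CompleteSpace X]
    (hX : EVIComparison.IsGeodesicSpace X)
    (𝓔 : X → EReal) (h𝓔 : EVIComparison.IsEnergy 𝓔)
    (κ : ℝ) (S : ℝ → X → X) (hS : EVIComparison.IsEVIFlow κ 𝓔 S)
    (hreg : EVIComparison.HasRegularizedGeodesics 𝓔)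
    (lam : ℝ) (hlam : 0 < lam)
    (hUp hLow : X → ℝ)
    (hUp_bdd : ∃ C : ℝ, ∀ x, |hUp x| ≤ C) (hUp_uc : UniformContinuous hUp)
    (hLow_bdd : ∃ C : ℝ, ∀ x, |hLow x| ≤ C) (hLow_uc : UniformContinuous hLow)
    (u v : X → ℝ)
    (hu : EVIComparison.IsSubsolution lam (EVIComparison.HUpper κ 𝓔 S) hUp u)
    (hv : EVIComparison.IsSupersolution lam (EVIComparison.HLower κ 𝓔 S) hLow v) :
    (⨆ x, (u x - v x)) ≤ ⨆ x, (hUp x - hLow x) := by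
  obtain ⟨x₀, -⟩ := h𝓔.proper
  have : Nonempty X := ⟨x₀⟩
  obtain ⟨C, hC⟩ := hUp_bdd
  obtain ⟨D, hD⟩ := hLow_bdd
  -- An unbounded real supremum defaults to `0`, so the bound is needed for the right-hand side to
  -- dominate each term.
  have hbdd : BddAbove (range fun x => hUp x - hLow x) :=
    ⟨C + D, forall_mem_range.2 fun x => by
      linarith [(abs_le.1 (hC x)).2, (abs_le.1 (hD x)).1]⟩
  refine ciSup_le fun x => le_of_forall_pos_le_add fun e he => ?_
  have hM : 0 < 6 + lam * (17 + 16 * |κ|) := by positivity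
  have hε : 0 < min 1 (e / (6 + lam * (17 + 16 * |κ|))) := by positivity
  have key := hu.sub_le hX h𝓔 hS hlam hUp_uc hv (le_ciSup hbdd) x hε (min_le_left _ _)
  have := mul_le_mul_of_nonneg_left (min_le_right 1 (e / (6 + lam * (17 + 16 * |κ|)))) hM.le
  rw [mul_div_cancel₀ _ hM.ne'] at this
  linarith
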